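/- Let $k$ be any (commutative) field. \textbf{Equivarieties.} A \emph{locally ringed space in $k$-algebras} is a topological space with a sheaf of commutative $k$-algebras whose stalks are local rings; morphisms are pairs (continuous map, morphism of sheaves of $k$-algebras) inducing local homomorphisms on stalks. For an ideal $I$ of $k[X_1,\dots,X_n]$ let $V=\{P\in k^n : p(P)=0\ \forall p\in I\}$ with the topology induced by the Zariski topology of $k^n$, and let $\mathcal O_V$ be its sheaf of regular functions, i.e. of functions $U\to k$ which are locally of the form $P\mapsto g(P)/h(P)$ with $g,h$ polynomials and $h$ without zero there; $(V,\mathcal O_V)$ is an \emph{affine algebraic subvariety}. Let $EVar^a_k$ be the category of \emph{equiresidual affine algebraic varieties} over $k$: the full subcategory of locally ringed spaces in $k$-algebras on the objects isomorphic to some affine algebraic subvariety of some $k^n$, $n\ge 0$. \textbf{Affine $*$-algebras.} A commutative $k$-algebra $A$ is a \emph{$*$-algebra} if $D(a_1,\dots,a_n)\in A^\times$ for all $n$, all $D\in k[X_1,\dots,X_n]$ with no zero in $k^n$ and all $a_1,\dots,a_n\in A$. It is \emph{affine} if moreover $A\cong\Gamma(V,\mathcal O_V)$ as $k$-algebras for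 some affine algebraic subvariety $V$. Let $*Aff_k$ be the full subcategory of $k$-algebras on the affine $*$-algebras. \textbf{The functors.} Let $J:(EVar^a_k)^{o}\to *Aff_k$ be the global sections functor, $J(V)=\Gamma(V,\mathcal O_V)$. For a $k$-algebra $A$, let $Spm(A)$ be the set of its maximal ideals with the Zariski topology, with the sheaf whose sections over $U$ are the maps $s:U\to\coprod_{\mathfrak m\in U}A/\mathfrak m$ with $s(\mathfrak m)\in A/\mathfrak m$ such that each point of $U$ has an open neighbourhood $W\subseteq U$ and elements $u,v\in A$ with $v\notin\mathfrak n$ and $s(\mathfrak n)=[u]/[v]$ in $A/\mathfrak n$ for all $\mathfrak n\in W$. \textbf{Theorem.} For every morphism $f:A\to B$ of affine $*$-algebras and every maximal ideal $\mathfrak n$ of $B$, the ideal $f^{-1}(\mathfrak n)$ is maximal in $A$, and for every affine $*$-algebra $A$, $Spm(A)$ is in $EVar^a_k$; hence there is a functor $K:*Aff_k\to (EVar^a_k)^{o}$ with $K(A)=Spm(A)$, which sends $f:A\to B$ to the morphism $Spm(B)\to Spm(A)$ given by $\mathfrak n\mapsto f^{-1}(\mathfrak n)$ on points and by $s\mapsto\big(\mathfrak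 n\mapsto \bar f_{\mathfrak n}(s(f^{-1}(\mathfrak n)))\big)$ on sections, where $\bar f_{\mathfrak n}:A/f^{-1}(\mathfrak n)\to B/\mathfrak n$ is induced by $f$. The functor $J$ is a duality between $EVar^a_k$ and $*Aff_k$, with adjoint the maximal spectrum functor $K$: both $J$ and $K$ are equivalences of categories, and there is an adjunction $J\dashv K$ whose unit and counit are isomorphisms, such that (1) for every affine $*$-algebra $A$, the counit $JK(A)\to A$ is inverse to the morphism $f_A:A\to \Gamma(Spm(A),\mathcal O_{Spm(A)})$, $a\mapsto(\mathfrak m\mapsto [a]\in A/\mathfrak m)$; (2) for every $V$ in $EVar^a_k$, the unit at $V$, seen as a morphism $KJ(V)\to V$ of $EVar^a_k$, is inverse to the canonical morphism $\phi_V:V\to Spm(\Gamma(V,\mathcal O_V))$, which sends a point $P$ to the ideal $\mathfrak m_P$ of the global sections whose germ at $P$ lies in the maximal ideal of $\mathcal O_{V,P}$, and which on sections satisfies: if $s$ is a section over $U$ and $s=[u]/[v]$ on an open $W\subseteq U$ with $u,v\in\Gamma(V,\mathcal O_V)$, then $v$ is invertible on $\phi_V^{-1}(W)$ and $\phi_V^\#(s)=u/v$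 on $\phi_V^{-1}(W)$. -/

import Mathlib

open CategoryTheory Limits AlgebraicGeometry TopologicalSpace Opposite

universe u

noncomputable section

namespace Equiresidual

section Prelim

variable (k : Type u) [Field k]

instance : PreservesLimits (forget (CommAlgCat.{u} k)) :=
  inferInstanceAs (PreservesLimits
    ((commAlgCatEquivUnder (.of k)).functor ⋙ Under.forget (CommRingCat.of k) ⋙
      forget CommRingCat.{u}))

instance : PreservesFilteredColimits (forget (CommAlgCat.{u} k)) :=
  inferInstanceAs (PreservesFilteredColimits
    ((commAlgCatEquivUnder (.of k)).functor ⋙ Under.forget (CommRingCat.of k) ⋙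
      forget CommRingCat.{u}))

end Prelim

/-! ### Locally ringed spaces in `k`-algebras -/

/-- A locally ringed space in `k`-algebras: a topological space with a sheaf of commutative
`k`-algebras all of whose stalks are local rings. -/
structure LRSAlg (k : Type u) [Field k] extends SheafedSpace.{_, _, u} (CommAlgCat.{u} k) where
  isLocalRing : ∀ x : toPresheafedSpace, IsLocalRing (presheaf.stalk x)

namespace LRSAlg

variable {k : Type u} [Field k]

attribute [instance] LRSAlg.isLocalRing

/-- A morphism of locally ringed spaces in `k`-algebras: a continuous map together with a morphism
of sheaves of `k`-algebras inducing local homomorphisms on the stalks. -/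
structure Hom (X Y : LRSAlg k) : Type u
    extends X.toPresheafedSpace.Hom Y.toPresheafedSpace where
  isLocalHom : ∀ x, IsLocalHom (toHom.stalkMap x).hom

instance : Category.{u} (LRSAlg k) where
  Hom X Y := Hom X Y
  id X := ⟨𝟙 X.toPresheafedSpace, fun x => by
    rw [PresheafedSpace.stalkMap.id]; exact ⟨fun _ h => h⟩⟩
  comp {X Y Z} f g := ⟨(f.toHom ≫ g.toHom : X.toPresheafedSpace ⟶ Z.toPresheafedSpace), fun x => by
    rw [PresheafedSpace.stalkMap.comp]
    exact ⟨fun a h => (g.isLocalHom _).map_nonunit _ ((f.isLocalHom x).map_nonunit _ h)⟩⟩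

lemma hom_ext {X Y : LRSAlg k} {f g : X ⟶ Y} (h : f.toHom = g.toHom) : f = g :=
  match f, g, h with
  | ⟨_, _⟩, ⟨_, _⟩, rfl => rfl

/-- The functor forgetting that the stalks are local. -/
def forgetToSheafedSpace (k : Type u) [Field k] :
    LRSAlg k ⥤ SheafedSpace.{_, _, u} (CommAlgCat.{u} k) where
  obj X := X.toSheafedSpace
  map f := InducedCategory.homMk f.toHom

/-- The global sections functor on locally ringed spaces in `k`-algebras. -/
def Γ (k : Type u) [Field k] : (LRSAlg k)ᵒᵖ ⥤ CommAlgCat.{u} k :=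
  (forgetToSheafedSpace k).op ⋙ SheafedSpace.Γ

end LRSAlg

/-! ### Sheaves of locally fractional sections -/

/-- A `k`-algebra `ring` evaluated at the points of a topological space, with values in fields
extending `k`, such that the non-vanishing locus of each element is open. -/
structure FracData (k : Type u) [Field k] where
  space : TopCat.{u}
  ring : Type u
  fiber : space → Type u
  [commRing : CommRing ring]
  [algebra : Algebra k ring]
  [fiberCommRing : ∀ x, CommRing (fiber x)]
  [fiberAlgebra : ∀ x, Algebra k (fiber x)]
  eval : ∀ x, ring →ₐ[k] fiber x
  isField_fiber : ∀ x, IsField (fiber x)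
  isOpen_ne_zero : ∀ u : ring, IsOpen {x : space | eval x u ≠ 0}

namespace FracData

attribute [instance] FracData.commRing FracData.algebra FracData.fiberCommRing
  FracData.fiberAlgebra

variable {k : Type u} [Field k] (X : FracData k)

/-- `s = u / v` on `W`: at every point `x` of `W`, the value of `v` is nonzero and `s x` is
the quotient `u x / v x` in the field at `x`. -/
def EqFrac {U : Opens X.space} (s : ∀ x : U, X.fiber x) (W : Opens X.space) (u v : X.ring) : Prop :=
  ∀ x (hx : x ∈ U), x ∈ W → X.eval x v ≠ 0 ∧ s ⟨x, hx⟩ * X.eval x v = X.eval x u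

lemma eval_mul_ne_zero {x : X.space} {v w : X.ring} (hv : X.eval x v ≠ 0) (hw : X.eval x w ≠ 0) :
    X.eval x (v * w) ≠ 0 := by
  let := (X.isField_fiber x).toField
  rw [map_mul]
  exact mul_ne_zero hv hw

/-- Sections which are locally equal to a fraction of elements of the ring. -/
def isLocallyFrac : TopCat.LocalPredicate X.fiber where
  pred {U} s := ∀ x ∈ U, ∃ W : Opens X.space, x ∈ W ∧ W ≤ U ∧ ∃ u v : X.ring, X.EqFrac s W u v
  res {V U} i s hs x hx := by
    obtain ⟨W, hxW, -, u, v, h⟩ := hs x (i.le hx)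
    exact ⟨W ⊓ V, ⟨hxW, hx⟩, inf_le_right, u, v, fun y hy hyW => h y (i.le hy) hyW.1⟩
  locality {U} s hs x hx := by
    obtain ⟨V, hxV, i, h⟩ := hs ⟨x, hx⟩
    obtain ⟨W, hxW, hWV, u, v, h⟩ := h x hxV
    exact ⟨W, hxW, hWV.trans i.le, u, v, fun y hy hyW => h y (hWV hyW) hyW⟩

/-- The `k`-algebra of locally fractional sections over `U`. -/
def sections (U : Opens X.space) : Subalgebra k (∀ x : U, X.fiber x) where
  carrier := {s | X.isLocallyFrac.pred s}
  mul_mem' {s t} hs ht x hx := by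
    obtain ⟨W, hxW, hWU, u, v, h⟩ := hs x hx
    obtain ⟨W', hxW', -, u', v', h'⟩ := ht x hx
    refine ⟨W ⊓ W', ⟨hxW, hxW'⟩, inf_le_left.trans hWU, u * u', v * v', fun y hy hyW => ?_⟩
    obtain ⟨h1, h2⟩ := h y hy hyW.1
    obtain ⟨h1', h2'⟩ := h' y hy hyW.2
    refine ⟨X.eval_mul_ne_zero h1 h1', ?_⟩
    rw [map_mul, map_mul, ← h2, ← h2', Pi.mul_apply]
    ring
  add_mem' {s t} hs ht x hx := by
    obtain ⟨W, hxW, hWU, u, v, h⟩ := hs x hx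
    obtain ⟨W', hxW', -, u', v', h'⟩ := ht x hx
    refine ⟨W ⊓ W', ⟨hxW, hxW'⟩, inf_le_left.trans hWU, u * v' + u' * v, v * v',
      fun y hy hyW => ?_⟩
    obtain ⟨h1, h2⟩ := h y hy hyW.1
    obtain ⟨h1', h2'⟩ := h' y hy hyW.2
    refine ⟨X.eval_mul_ne_zero h1 h1', ?_⟩
    rw [map_mul, map_add, map_mul, map_mul, ← h2, ← h2', Pi.add_apply]
    ring
  algebraMap_mem' c x hx := by
    refine ⟨U, hx, le_rfl, algebraMap k X.ring c, 1, fun y hy _ => ⟨?_, ?_⟩⟩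
    · have := (X.isField_fiber y).nontrivial
      rw [map_one]
      exact one_ne_zero
    · rw [map_one, mul_one, AlgHom.commutes]
      rfl

/-- Restriction of sections. -/
def res {U V : Opens X.space} (h : V ≤ U) : X.sections U →ₐ[k] X.sections V where
  toFun s := ⟨fun x => s.1 ⟨x.1, h x.2⟩, X.isLocallyFrac.res (homOfLE h) s.1 s.2⟩
  map_one' := rfl
  map_mul' _ _ := rfl
  map_zero' := rfl
  map_add' _ _ := rfl
  commutes' _ := rfl

/-- The presheaf of locally fractional sections. -/
def presheaf : X.space.Presheaf (CommAlgCat.{u} k) where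
  obj U := .of k (X.sections U.unop)
  map i := CommAlgCat.ofHom (X.res i.unop.le)

lemma isSheaf_presheaf : X.presheaf.IsSheaf := by
  rw [TopCat.Presheaf.isSheaf_iff_isSheaf_comp (forget (CommAlgCat.{u} k))]
  exact TopCat.Presheaf.isSheaf_of_iso
    (F := TopCat.subpresheafToTypes X.isLocallyFrac.toPrelocalPredicate)
    (NatIso.ofComponents fun _ => Iso.refl _)
    (TopCat.subpresheafToTypes.isSheaf X.isLocallyFrac)

lemma isUnit_section {U : Opens X.space} (s : X.sections U) (hs : ∀ x, s.1 x ≠ 0) : IsUnit s := by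
  choose inv hinv using fun y : U => (X.isField_fiber y.1).mul_inv_cancel (hs y)
  let t : X.sections U := ⟨inv, fun x hx => by
    obtain ⟨W, hxW, hWU, u, v, h⟩ := s.2 x hx
    refine ⟨W, hxW, hWU, v, u, fun y hy hyW => ?_⟩
    obtain ⟨h1, h2⟩ := h y hy hyW
    rw [← h2]
    refine ⟨?_, ?_⟩
    · let := (X.isField_fiber y).toField
      exact mul_ne_zero (hs ⟨y, hy⟩) h1
    · rw [← mul_assoc, mul_comm (inv _), hinv, one_mul]⟩
  exact IsUnit.of_mul_eq_one t (Subtype.ext (funext hinv))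

/-- The underlying sheafed space. -/
def toSheafedSpace : SheafedSpace.{_, _, u} (CommAlgCat.{u} k) where
  carrier := X.space
  presheaf := X.presheaf
  IsSheaf := X.isSheaf_presheaf

/-- Evaluation of germs at a point. -/
def stalkEval (x : X.space) : X.presheaf.stalk x ⟶ CommAlgCat.of k (X.fiber x) :=
  colimit.desc _
    { pt := CommAlgCat.of k (X.fiber x)
      ι :=
        { app := fun U => CommAlgCat.ofHom
            ((Pi.evalAlgHom k (fun y : U.unop.1 => X.fiber y) ⟨x, U.unop.2⟩).comp
              (X.sections U.unop.1).val)
          naturality := fun _ _ _ => rfl } }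

lemma stalkEval_germ (x : X.space) (U : Opens X.space) (hx : x ∈ U) (s : X.sections U) :
    (X.stalkEval x).hom ((X.presheaf.germ U x hx).hom s) = s.1 ⟨x, hx⟩ := by
  have : X.presheaf.germ U x hx ≫ X.stalkEval x = CommAlgCat.ofHom
      ((Pi.evalAlgHom k (fun y : U => X.fiber y) ⟨x, hx⟩).comp (X.sections U).val) :=
    colimit.ι_desc _ _
  exact DFunLike.congr_fun (congrArg CommAlgCat.Hom.hom this) s

lemma isUnit_of_stalkEval_ne_zero (x : X.space) (a : X.presheaf.stalk x)
    (ha : (X.stalkEval x).hom a ≠ 0) : IsUnit a := by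
  obtain ⟨U, hxU, s, rfl⟩ := TopCat.Presheaf.exists_germ_eq X.presheaf a
  obtain ⟨W, hxW, hWU, u, v, h⟩ := s.2 x hxU
  have ha' : s.1 ⟨x, hxU⟩ ≠ 0 := fun h0 => ha ((X.stalkEval_germ x U hxU s).trans h0)
  have hux : X.eval x u ≠ 0 := by
    let := (X.isField_fiber x).toField
    rw [← (h x hxU hxW).2]
    exact mul_ne_zero ha' (h x hxU hxW).1
  let W' : Opens X.space := W ⊓ ⟨_, X.isOpen_ne_zero u⟩
  have hW'U : W' ≤ U := inf_le_left.trans hWU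
  have hunit : IsUnit (X.res hW'U s) := X.isUnit_section _ fun y h0 => y.2.2 <| by
    rw [← (h y.1 (hW'U y.2) y.2.1).2]
    change (X.res hW'U s).1 y * _ = 0
    rw [h0, zero_mul]
  have hgerm : (X.presheaf.germ U x hxU).hom s =
      (X.presheaf.germ W' x ⟨hxW, hux⟩).hom (X.res hW'U s) :=
    (TopCat.Presheaf.germ_res_apply X.presheaf (homOfLE hW'U) x ⟨hxW, hux⟩ s).symm
  change IsUnit ((X.presheaf.germ U x hxU).hom s)
  rw [hgerm]
  exact hunit.map (X.presheaf.germ W' x ⟨hxW, hux⟩).hom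

instance isLocalHom_stalkEval (x : X.space) : IsLocalHom (X.stalkEval x).hom :=
  ⟨fun a ha => X.isUnit_of_stalkEval_ne_zero x a <| by
    have := (X.isField_fiber x).nontrivial
    exact ha.ne_zero⟩

lemma isLocalRing_stalk (x : X.space) : IsLocalRing (X.presheaf.stalk x) := by
  have hl : IsLocalRing (X.fiber x) := by
    let := (X.isField_fiber x).toField
    exact @Field.instIsLocalRing _ this
  have : IsLocalHom (X.stalkEval x).hom.toRingHom :=
    ⟨fun a h => (X.isLocalHom_stalkEval x).map_nonunit a h⟩
  exact RingHom.domain_isLocalRing (X.stalkEval x).hom.toRingHom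

/-- The locally ringed space in `k`-algebras of locally fractional sections. -/
def toLRSAlg : LRSAlg k where
  toSheafedSpace := X.toSheafedSpace
  isLocalRing := X.isLocalRing_stalk

/-- An element of the ring, seen as a global section. -/
def toGlobal : X.ring →ₐ[k] X.sections ⊤ where
  toFun a := ⟨fun x => X.eval x.1 a, fun x _ => ⟨⊤, trivial, le_rfl, a, 1, fun y _ _ => by
    have := (X.isField_fiber y).nontrivial
    rw [map_one, mul_one]
    exact ⟨one_ne_zero, rfl⟩⟩⟩
  map_one' := Subtype.ext <| funext fun _ => map_one _
  map_mul' _ _ := Subtype.ext <| funext fun _ => map_mul _ _ _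
  map_zero' := Subtype.ext <| funext fun _ => map_zero _
  map_add' _ _ := Subtype.ext <| funext fun _ => map_add _ _ _
  commutes' _ := Subtype.ext <| funext fun _ => AlgHom.commutes _ _

variable {X} {Y : FracData k}

/-- A continuous map together with compatible maps of the rings and of the fields at the points. -/
structure Hom (X Y : FracData k) where
  base : X.space ⟶ Y.space
  ringHom : Y.ring →ₐ[k] X.ring
  fiberHom : ∀ x, Y.fiber (base x) →ₐ[k] X.fiber x
  fiberHom_eval : ∀ x a, fiberHom x (Y.eval (base x) a) = X.eval x (ringHom a)

namespace Hom

variable (f : Hom X Y)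

lemma fiberHom_ne_zero (x : X.space) {a : Y.fiber (f.base x)} (ha : a ≠ 0) :
    f.fiberHom x a ≠ 0 := by
  let := (Y.isField_fiber (f.base x)).toField
  have := (X.isField_fiber x).nontrivial
  exact (map_ne_zero (f.fiberHom x)).mpr ha

/-- Pullback of sections: `s` is sent to `x ↦ fiberHom x (s (base x))`. -/
def onSections (U : Opens Y.space) :
    Y.sections U →ₐ[k] X.sections ((Opens.map f.base).obj U) where
  toFun s := ⟨fun x => f.fiberHom x.1 (s.1 ⟨f.base x.1, x.2⟩), fun x hx => by
    obtain ⟨W, hxW, hWU, u, v, h⟩ := s.2 (f.base x) hx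
    refine ⟨(Opens.map f.base).obj W, hxW, fun y hy => hWU hy, f.ringHom u, f.ringHom v,
      fun y hy hyW => ?_⟩
    obtain ⟨h1, h2⟩ := h (f.base y) hy hyW
    rw [← f.fiberHom_eval, ← f.fiberHom_eval, ← h2, map_mul]
    exact ⟨f.fiberHom_ne_zero y h1, rfl⟩⟩
  map_one' := Subtype.ext <| funext fun _ => map_one _
  map_mul' _ _ := Subtype.ext <| funext fun _ => map_mul _ _ _
  map_zero' := Subtype.ext <| funext fun _ => map_zero _
  map_add' _ _ := Subtype.ext <| funext fun _ => map_add _ _ _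
  commutes' _ := Subtype.ext <| funext fun _ => AlgHom.commutes _ _

/-- The induced morphism of sheafed spaces. -/
def toPresheafedSpaceHom :
    X.toSheafedSpace.toPresheafedSpace.Hom Y.toSheafedSpace.toPresheafedSpace where
  base := f.base
  c := { app := fun U => CommAlgCat.ofHom (f.onSections U.unop)
         naturality := fun _ _ _ => rfl }

lemma isLocalHom_stalkMap (x : X.space) :
    IsLocalHom (f.toPresheafedSpaceHom.stalkMap x).hom := ⟨fun a ha => by
    apply Y.isUnit_of_stalkEval_ne_zero (f.base x) a
    intro h0
    obtain ⟨U, hxU, s, rfl⟩ := TopCat.Presheaf.exists_germ_eq Y.presheaf a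
    have hs : s.1 ⟨f.base x, hxU⟩ = 0 := (Y.stalkEval_germ (f.base x) U hxU s).symm.trans h0
    have h2 : (f.toPresheafedSpaceHom.stalkMap x).hom ((Y.presheaf.germ U (f.base x) hxU).hom s)
        = (X.presheaf.germ ((Opens.map f.base).obj U) x hxU).hom (f.onSections U s) :=
      DFunLike.congr_fun (congrArg CommAlgCat.Hom.hom
        (PresheafedSpace.stalkMap_germ f.toPresheafedSpaceHom U x hxU)) s
    have h3 : IsUnit ((f.toPresheafedSpaceHom.stalkMap x).hom
      ((Y.presheaf.germ U (f.base x) hxU).hom s)) := ha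
    rw [h2] at h3
    have h4 : IsUnit ((X.stalkEval x).hom
      ((X.presheaf.germ ((Opens.map f.base).obj U) x hxU).hom (f.onSections U s))) :=
      h3.map (X.stalkEval x).hom
    rw [X.stalkEval_germ x _ hxU (f.onSections U s)] at h4
    have h5 : (f.onSections U s).1 ⟨x, hxU⟩ = 0 := by
      change f.fiberHom x (s.1 ⟨f.base x, hxU⟩) = 0
      rw [hs, map_zero]
    rw [h5] at h4
    have := (X.isField_fiber x).nontrivial
    exact not_isUnit_zero h4⟩

/-- The induced morphism of locally ringed spaces in `k`-algebras. -/
def toLRSAlgHom : X.toLRSAlg ⟶ Y.toLRSAlg where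
  toHom := f.toPresheafedSpaceHom
  isLocalHom := f.isLocalHom_stalkMap

end Hom

end FracData

/-! ### Affine algebraic subvarieties and affine algebraic equivarieties -/

section

variable (k : Type u) [Field k]

/-- The affine space `k ^ n`, with its Zariski topology. -/
def AffineSpace (n : ℕ) : Type u := Fin n → k

variable {k} in
/-- The algebraic set `Z(I)` in `k ^ n` of the common zeros of the polynomials of `I`. -/
def zeroSet {n : ℕ} (I : Ideal (MvPolynomial (Fin n) k)) : Set (AffineSpace k n) :=
  {P | ∀ p ∈ I, MvPolynomial.aeval (R := k) (S₁ := k) P p = 0}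

/-- The Zariski topology of `k ^ n`: the closed sets are the algebraic sets. -/
instance AffineSpace.zariskiTopology (n : ℕ) : TopologicalSpace (AffineSpace k n) :=
  TopologicalSpace.ofClosed
    (Set.range fun I : Ideal (MvPolynomial (Fin n) k) => zeroSet I)
    ⟨⊤, Set.eq_empty_of_forall_notMem fun P hP => one_ne_zero ((map_one _).symm.trans
      (hP 1 trivial))⟩
    (fun A hA => ⟨sSup {I | zeroSet I ∈ A}, by
      ext P
      constructor
      · intro h V hV
        obtain ⟨I, rfl⟩ := hA hV
        exact fun p hp => h p (le_sSup (show I ∈ {I | zeroSet I ∈ A} from hV) hp)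
      · intro h p hp
        have : sSup {I | zeroSet I ∈ A} ≤
            RingHom.ker (MvPolynomial.aeval (R := k) (S₁ := k) P) :=
          sSup_le fun I hI q hq => h _ hI q hq
        exact this hp⟩)
    (by
      rintro _ ⟨I, rfl⟩ _ ⟨J, rfl⟩
      refine ⟨I * J, ?_⟩
      ext P
      constructor
      · intro h
        by_contra hc
        obtain ⟨h1, h2⟩ := not_or.mp hc
        obtain ⟨p, hp⟩ := not_forall.mp h1
        obtain ⟨q, hq⟩ := not_forall.mp h2
        obtain ⟨hp, hp'⟩ := Classical.not_imp.mp hp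
        obtain ⟨hq, hq'⟩ := Classical.not_imp.mp hq
        have h3 := h (p * q) (Ideal.mul_mem_mul hp hq)
        rw [map_mul] at h3
        exact (mul_ne_zero hp' hq') h3
      · rintro (h | h) p hp
        · have hp' : p ∈ I := (Ideal.mul_le_left : I * J ≤ I) hp
          exact h p hp'
        · have hp' : p ∈ J := (Ideal.mul_le_right : I * J ≤ J) hp
          exact h p hp')

variable {k}

lemma isClosed_zeroSet {n : ℕ} (I : Ideal (MvPolynomial (Fin n) k)) : IsClosed (zeroSet I) :=
  ⟨⟨I, (compl_compl _).symm⟩⟩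

/-- The data defining the regular functions on the algebraic set `V = Z(I) ⊆ k ^ n` (with the
induced Zariski topology): polynomials, evaluated at the points of `V`. -/
def affineData {n : ℕ} (I : Ideal (MvPolynomial (Fin n) k)) : FracData k where
  space := TopCat.of {P : AffineSpace k n // P ∈ zeroSet I}
  ring := MvPolynomial (Fin n) k
  fiber _ := k
  eval P := MvPolynomial.aeval P.1
  isField_fiber _ := Field.toIsField k
  isOpen_ne_zero u := by
    have h : zeroSet (Ideal.span {u}) =
        {P : AffineSpace k n | MvPolynomial.aeval (R := k) (S₁ := k) P u = 0} := by
      ext P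
      exact ⟨fun h => h u (Ideal.mem_span_singleton_self u), fun h p hp =>
        (Ideal.span_singleton_le_iff_mem
          (RingHom.ker (MvPolynomial.aeval (R := k) (S₁ := k) P))).mpr h hp⟩
    have := isClosed_zeroSet (Ideal.span {u})
    rw [h] at this
    exact (this.preimage continuous_subtype_val).isOpen_compl

/-- The affine algebraic subvariety `(V, O_V)` of `k ^ n` with `V = Z(I)`: sections of `O_V` over
an open `U ⊆ V` are the regular functions `U → k`, i.e. the functions which are locally of the
form `P ↦ g(P) / h(P)` for polynomials `g, h` with `h` nowhere zero. -/
def affineSubvariety {n : ℕ} (I : Ideal (MvPolynomial (Fin n) k)) : LRSAlg k :=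
  (affineData I).toLRSAlg

variable (k)

/-- Affine algebraic equivarieties over `k`: the locally ringed spaces in `k`-algebras which are
isomorphic to an affine algebraic subvariety of some `k ^ n` (so that, in particular, every point
has a neighbourhood, namely the whole space, which is isomorphic to such a subvariety). -/
def IsAffineEquivariety : ObjectProperty (LRSAlg k) := fun X =>
  ∃ (n : ℕ) (I : Ideal (MvPolynomial (Fin n) k)), Nonempty (X ≅ affineSubvariety I)

/-- The category `EVar^a_k` of affine algebraic equivarieties over `k`, a full subcategory of the
category of locally ringed spaces in `k`-algebras. -/
abbrev AffineEquivariety : Type (u + 1) := (IsAffineEquivariety k).FullSubcategory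

/-! ### Affine `*`-algebras -/

/-- A `k`-algebra `A` is a `*`-algebra if `D(a₁, …, aₙ)` is invertible in `A` for every polynomial
`D` over `k` without zero rational in `k`, and all `a₁, …, aₙ` in `A`. -/
def IsStarAlgebra (A : Type u) [CommRing A] [Algebra k A] : Prop :=
  ∀ (n : ℕ) (D : MvPolynomial (Fin n) k), (∀ c : Fin n → k, MvPolynomial.eval c D ≠ 0) →
    ∀ a : Fin n → A, IsUnit (MvPolynomial.aeval a D)

/-- An affine `*`-algebra is a `*`-algebra isomorphic to the algebra of global sections of the
sheaf of regular functions of an affine algebraic subvariety of some `k ^ n`. -/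
def IsAffineStarAlgebra : ObjectProperty (CommAlgCat.{u} k) := fun A =>
  IsStarAlgebra k A ∧ ∃ (n : ℕ) (I : Ideal (MvPolynomial (Fin n) k)),
    Nonempty (A ≅ (LRSAlg.Γ k).obj (op (affineSubvariety I)))

/-- The category `*Aff_k` of affine `*`-algebras, a full subcategory of the category of
`k`-algebras. -/
abbrev AffineStarAlgebra : Type (u + 1) := (IsAffineStarAlgebra k).FullSubcategory

variable {k}

lemma IsStarAlgebra.of_algEquiv {A B : Type u} [CommRing A] [Algebra k A] [CommRing B]
    [Algebra k B] (e : A ≃ₐ[k] B) (hB : IsStarAlgebra k B) : IsStarAlgebra k A := by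
  intro n D hD a
  have h := (hB n D hD (fun i => e (a i))).map e.symm
  have h2 : MvPolynomial.aeval (fun i => e (a i)) D = e (MvPolynomial.aeval a D) :=
    (DFunLike.congr_fun (MvPolynomial.comp_aeval a e.toAlgHom) D).symm
  rwa [h2, e.symm_apply_apply] at h

lemma isStarAlgebra_sections {n : ℕ} (I : Ideal (MvPolynomial (Fin n) k)) :
    IsStarAlgebra k ((affineData I).sections ⊤) := by
  intro m D hD a
  refine (affineData I).isUnit_section _ fun P => ?_
  have h : MvPolynomial.aeval (fun i => (a i).1 P) D = (MvPolynomial.aeval a D).1 P :=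
    (DFunLike.congr_fun (MvPolynomial.comp_aeval a
      ((Pi.evalAlgHom k (fun y => (affineData I).fiber y.1) P).comp
        ((affineData I).sections ⊤).val)) D).symm
  rw [← h]
  exact hD _

lemma isAffineStarAlgebra_Γ (X : AffineEquivariety k) :
    IsAffineStarAlgebra k ((LRSAlg.Γ k).obj (op X.obj)) := by
  obtain ⟨n, I, ⟨e⟩⟩ := X.property
  have e' := (LRSAlg.Γ k).mapIso e.symm.op
  exact ⟨(isStarAlgebra_sections I).of_algEquiv (CommAlgCat.algEquivOfIso e'), n, I, ⟨e'⟩⟩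

variable (k) in
/-- The global sections functor `J`, from the dual of the category of affine algebraic
equivarieties to the category of affine `*`-algebras. -/
def J : (AffineEquivariety k)ᵒᵖ ⥤ AffineStarAlgebra k :=
  (IsAffineStarAlgebra k).lift ((IsAffineEquivariety k).ι.op ⋙ LRSAlg.Γ k)
    fun X => isAffineStarAlgebra_Γ X.unop

/-! ### The maximal spectrum -/

/-- The data defining the structure sheaf on `Spm(A)` (with the Zariski topology): elements of `A`,
taking values in the residue fields `A / m`. -/
def spmData (A : Type u) [CommRing A] [Algebra k A] : FracData k where
  space := TopCat.of (MaximalSpectrum A)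
  ring := A
  fiber m := A ⧸ m.asIdeal
  eval m := Ideal.Quotient.mkₐ k m.asIdeal
  isField_fiber m :=
    (Ideal.Quotient.maximal_ideal_iff_isField_quotient m.asIdeal).mp m.isMaximal
  isOpen_ne_zero u := by
    have := (PrimeSpectrum.basicOpen u).2.preimage
      (MaximalSpectrum.toPrimeSpectrum_continuous (R := A))
    convert this using 1
    ext m
    exact not_congr Ideal.Quotient.eq_zero_iff_mem

/-- The maximal spectrum `Spm(A)` of a `k`-algebra, with the sheaf whose sections over `U` are the
maps `s` sending each `m ∈ U` to an element of `A / m`, and locally of the form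
`m ↦ [u] / [v]` for `u, v ∈ A`. -/
def spm (A : Type u) [CommRing A] [Algebra k A] : LRSAlg k := (spmData (k := k) A).toLRSAlg

/-- For `f : A → B` pulling back maximal ideals to maximal ideals, the continuous map
`n ↦ f⁻¹(n)` from `Spm(B)` to `Spm(A)` and the field morphisms `A / f⁻¹(n) → B / n`
induced by `f`. -/
def spmDataHom {A B : Type u} [CommRing A] [Algebra k A] [CommRing B] [Algebra k B] (f : A →ₐ[k] B)
    (hf : ∀ n : MaximalSpectrum B, (n.asIdeal.comap f).IsMaximal) :
    (spmData (k := k) B).Hom (spmData A) where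
  base := TopCat.ofHom
    { toFun := fun n => (⟨n.asIdeal.comap f, hf n⟩ : MaximalSpectrum A)
      continuous_toFun := by
        refine continuous_induced_rng.mpr ?_
        exact (PrimeSpectrum.continuous_comap f.toRingHom).comp
          (MaximalSpectrum.toPrimeSpectrum_continuous (R := B)) }
  ringHom := f
  fiberHom n := Ideal.quotientMapₐ n.asIdeal f le_rfl
  fiberHom_eval _ _ := rfl

/-- The morphism `Spm(B) → Spm(A)` induced by `f : A → B`: on points `n ↦ f⁻¹(n)`, and
on sections `s ↦ (n ↦ (f / n) (s (f⁻¹(n))))` with `f / n : A / f⁻¹(n) → B / n`. -/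
def spmMap {A B : Type u} [CommRing A] [Algebra k A] [CommRing B] [Algebra k B] (f : A →ₐ[k] B)
    (hf : ∀ n : MaximalSpectrum B, (n.asIdeal.comap f).IsMaximal) :
    spm (k := k) B ⟶ spm A := (spmDataHom f hf).toLRSAlgHom

lemma quotientMapₐ_id {A : Type u} [CommRing A] [Algebra k A] (I : Ideal A)
    (h : I ≤ I.comap (AlgHom.id k A)) (x : A ⧸ I) :
    Ideal.quotientMapₐ I (AlgHom.id k A) h x = x := by
  obtain ⟨a, rfl⟩ := Ideal.Quotient.mk_surjective x
  rfl

lemma quotientMapₐ_comp {A B C : Type u} [CommRing A] [Algebra k A] [CommRing B] [Algebra k B]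
    [CommRing C] [Algebra k C] (f : A →ₐ[k] B) (g : B →ₐ[k] C) (I : Ideal C)
    (x : A ⧸ I.comap (g.comp f)) :
    Ideal.quotientMapₐ I (g.comp f) le_rfl x = Ideal.quotientMapₐ I g le_rfl
      (Ideal.quotientMapₐ (I.comap g) f (le_refl ((I.comap g).comap f)) x) := by
  obtain ⟨a, rfl⟩ := Ideal.Quotient.mk_surjective x
  rfl

variable (k) in
/-- The maximal spectrum is well defined as a functor on affine `*`-algebras, with values in affine
algebraic equivarieties. -/
structure SpmWellDefined : Prop where
  comap_isMaximal : ∀ {A B : AffineStarAlgebra k} (f : A ⟶ B) (n : MaximalSpectrum B.obj),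
    (n.asIdeal.comap f.hom.hom).IsMaximal
  isAffineEquivariety : ∀ A : AffineStarAlgebra k, IsAffineEquivariety k (spm A.obj)

/-- The maximal spectrum functor `K`, from the category of affine `*`-algebras to the dual of the
category of affine algebraic equivarieties. -/
def K (h : SpmWellDefined k) : AffineStarAlgebra k ⥤ (AffineEquivariety k)ᵒᵖ where
  obj A := op ⟨spm A.obj, h.isAffineEquivariety A⟩
  map {A B} f := (ObjectProperty.homMk (spmMap f.hom.hom (h.comap_isMaximal f))).op
  map_id A := by
    refine congrArg Quiver.Hom.op (ObjectProperty.hom_ext _ (LRSAlg.hom_ext ?_))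
    refine PresheafedSpace.hext _ _ rfl (heq_of_eq (NatTrans.ext (funext fun U => ?_)))
    refine CommAlgCat.hom_ext (AlgHom.ext fun s => Subtype.ext (funext fun n => ?_))
    exact quotientMapₐ_id n.1.asIdeal _ (s.1 n)
  map_comp {A B C} f g := by
    refine congrArg Quiver.Hom.op (ObjectProperty.hom_ext _ (LRSAlg.hom_ext ?_))
    refine PresheafedSpace.hext _ _ rfl (heq_of_eq (NatTrans.ext (funext fun U => ?_)))
    refine CommAlgCat.hom_ext (AlgHom.ext fun s => Subtype.ext (funext fun n => ?_))
    exact quotientMapₐ_comp f.hom.hom g.hom.hom n.1.asIdeal _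

/-- The canonical morphism `A → Γ(Spm(A))` sending `a` to the section `m ↦ [a] ∈ A / m`. -/
def toΓSpm (A : CommAlgCat.{u} k) : A ⟶ (LRSAlg.Γ k).obj (op (spm A)) :=
  CommAlgCat.ofHom (spmData A).toGlobal

/-- The characterisation of the canonical morphism `φ : X → Spm(Γ(X))`. On points it sends `P` to
the ideal `m_P` of the global sections whose germ at `P` lies in the maximal ideal of the local
ring at `P`. On sections, if `s = [u] / [v]` on `W ⊆ U`, with `u, v ∈ Γ(X)`, then the section
`φ^#(s)` over `φ⁻¹(U)` is the quotient `u / v` on `φ⁻¹(W)`. -/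
def IsCanonicalToSpmΓ {X : LRSAlg k} (φ : X ⟶ spm ((LRSAlg.Γ k).obj (op X))) : Prop :=
  (∀ (P : X.carrier) (a : X.presheaf.obj (op ⊤)),
    a ∈ (show MaximalSpectrum ((LRSAlg.Γ k).obj (op X)) from φ.base P).asIdeal ↔
      (X.presheaf.germ ⊤ P trivial).hom a ∈ IsLocalRing.maximalIdeal (X.presheaf.stalk P)) ∧
  ∀ (U W : Opens (spmData (k := k) ((LRSAlg.Γ k).obj (op X))).space) (hWU : W ≤ U)
    (s : (spmData (k := k) ((LRSAlg.Γ k).obj (op X))).sections U)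
    (u v : X.presheaf.obj (op ⊤)),
    (spmData ((LRSAlg.Γ k).obj (op X))).EqFrac s.1 W u v →
      IsUnit ((X.presheaf.map (homOfLE (le_top : (Opens.map φ.base).obj W ≤ ⊤)).op).hom v) ∧
      (X.presheaf.map ((Opens.map φ.base).map (homOfLE hWU)).op).hom ((φ.c.app (op U)).hom s) *
        (X.presheaf.map (homOfLE (le_top : (Opens.map φ.base).obj W ≤ ⊤)).op).hom v =
      (X.presheaf.map (homOfLE (le_top : (Opens.map φ.base).obj W ≤ ⊤)).op).hom u

end

end Equiresidual
end

/-! The proof rests on one statement about polynomials (`exists_mem_forall_aeval_ne_zero`): an ideal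
of k[X_1, ..., X_n] without rational zeros contains a single polynomial without rational zeros. If k
is algebraically closed, the Nullstellensatz makes the ideal contain 1. Otherwise some one-variable
polynomial of positive degree has no root in k; its homogenization is a binary form whose only zero
is (0, 0), and substituting elements into such forms merges finitely many generators into one
element with the same rational zeros.

This replaces the Nullstellensatz twice. Applied to the ideal of denominators of a global regular
function on V, it shows that the function is a global fraction of polynomials
(`exists_mul_polySection_eq`). Applied to the contraction of a maximal ideal of Γ(V), it shows that
this ideal consists of the functions vanishing at some point, since a polynomial without rational
zeros is a unit in Γ(V) (`idealPoint_surjective`). Hence points of V and maximal ideals of Γ(V)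
correspond homeomorphically, all residue fields equal k, and Spm(Γ(V)) is isomorphic to V as a
ringed space (`spmIso`).

The rest is formal. A morphism X → Spm(A) is determined by the algebra map A → Γ(X) that it induces
(`hom_spm_ext`): this map fixes the points through the local stalk maps, and the sections because
they are locally fractions. So naturality and the triangle identity reduce to equalities of algebra
maps, and a morphism V → Spm(Γ(V)) inducing the identity of Γ(V) is the canonical one. -/

noncomputable section

namespace Equiresidual

/-! ### Ideals of polynomials without rational zeros -/

section Polynomials

variable {k : Type u} [Field k]

/-- Over a field with a rootless polynomial `p`, the homogenization of `p` evaluated at `a, b`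
vanishes exactly when `a` and `b` do. -/
lemma sum_coeff_mul_pow_eq_zero_iff {p : Polynomial k} (hp : ∀ x, p.eval x ≠ 0)
    (hd : 0 < p.natDegree) (a b : k) :
    ∑ i ∈ Finset.range (p.natDegree + 1), p.coeff i * a ^ i * b ^ (p.natDegree - i) = 0 ↔
      a = 0 ∧ b = 0 := by
  constructor
  · intro h
    by_cases hb : b = 0
    · subst hb
      -- With b = 0 only the top term survives, and the leading coefficient is nonzero because p has
      -- no root.
      rw [Finset.sum_range_succ, Finset.sum_eq_zero] at h
      · have hlc : p.coeff p.natDegree ≠ 0 := by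
          rw [Polynomial.coeff_natDegree, Polynomial.leadingCoeff_ne_zero]
          rintro rfl
          exact hp 0 Polynomial.eval_zero
        simp only [tsub_self, pow_zero, mul_one, zero_add, mul_eq_zero, hlc, false_or] at h
        exact ⟨eq_zero_of_pow_eq_zero h, rfl⟩
      · intro i hi
        rw [zero_pow (by have := Finset.mem_range.mp hi; omega), mul_zero]
    · refine absurd ?_ (hp (a / b))
      -- Dehomogenization: for b ≠ 0 a zero (a, b) of the form would give the root a / b of p.
      have hs : ∑ i ∈ Finset.range (p.natDegree + 1), p.coeff i * a ^ i * b ^ (p.natDegree - i) =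
          b ^ p.natDegree * p.eval (a / b) := by
        rw [Polynomial.eval_eq_sum_range, Finset.mul_sum]
        refine Finset.sum_congr rfl fun i hi => ?_
        have hi' : i ≤ p.natDegree := Nat.lt_succ_iff.mp (Finset.mem_range.mp hi)
        rw [pow_sub₀ b hb hi', div_pow]
        field_simp
      rw [hs] at h
      exact (mul_eq_zero.mp h).resolve_left (pow_ne_zero _ hb)
  · rintro ⟨rfl, rfl⟩
    refine Finset.sum_eq_zero fun i hi => ?_
    rcases Nat.eq_zero_or_pos i with rfl | hi0
    · rw [tsub_zero, zero_pow hd.ne', mul_zero]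
    · rw [zero_pow hi0.ne', mul_zero, zero_mul]

/-- An irreducible polynomial without root serves. The positive degree excludes nonzero constants,
whose homogenization has no zero at all and does not lie in the ideal generated by the two
variables. -/
lemma exists_eval_ne_zero_of_not_isAlgClosed (h : ¬ IsAlgClosed k) :
    ∃ p : Polynomial k, (∀ x, p.eval x ≠ 0) ∧ 0 < p.natDegree := by
  by_contra! hc
  refine h (IsAlgClosed.of_exists_root k fun p _ hp => ?_)
  by_contra! hr
  have := hc p hr
  exact (Irreducible.natDegree_pos hp).not_ge this

/-- Over a field which is not algebraically closed, a finitely generated ideal of polynomials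
contains a single polynomial with the same rational zeros. -/
lemma exists_mem_eval_eq_zero_iff (h : ¬ IsAlgClosed k) {n : ℕ}
    {J : Ideal (MvPolynomial (Fin n) k)} (hJ : J.FG) :
    ∃ d ∈ J, ∀ P : Fin n → k, MvPolynomial.aeval P d = 0 → ∀ q ∈ J, MvPolynomial.aeval P q = 0 := by
  obtain ⟨p, hp, hd⟩ := exists_eval_ne_zero_of_not_isAlgClosed h
  refine Submodule.fg_induction (R := MvPolynomial (Fin n) k) (M := MvPolynomial (Fin n) k)
    (motive := fun J _ => ∃ d ∈ J, ∀ P : Fin n → k, MvPolynomial.aeval P d = 0 →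
      ∀ q ∈ J, MvPolynomial.aeval P q = 0) (fun f => ?_) (fun J₁ J₂ _ _ h₁ h₂ => ?_) J hJ
  · refine ⟨f, Submodule.mem_span_singleton_self f, fun P hP q hq => ?_⟩
    obtain ⟨c, rfl⟩ := Ideal.mem_span_singleton'.mp hq
    rw [map_mul, hP, mul_zero]
  · obtain ⟨d₁, hd₁, h₁⟩ := h₁
    obtain ⟨d₂, hd₂, h₂⟩ := h₂
    -- The homogenization of p at (d₁, d₂): it vanishes at P exactly when both d₁ and d₂ do.
    -- Positive degree puts a factor d₁ or d₂ in every term, hence the sum in J₁ ⊔ J₂.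
    refine ⟨∑ i ∈ Finset.range (p.natDegree + 1),
      MvPolynomial.C (p.coeff i) * d₁ ^ i * d₂ ^ (p.natDegree - i),
      Ideal.sum_mem _ fun i hi => ?_, fun P hP q hq => ?_⟩
    · rcases Nat.eq_zero_or_pos i with rfl | hi0
      · exact Ideal.mul_mem_left _ _ (Ideal.pow_mem_of_mem (J₁ ⊔ J₂) (Submodule.mem_sup_right hd₂) _
          (by omega))
      · exact Ideal.mul_mem_right _ _ (Ideal.mul_mem_left _ _
          (Ideal.pow_mem_of_mem (J₁ ⊔ J₂) (Submodule.mem_sup_left hd₁) _ hi0))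
    · simp only [map_sum, map_mul, map_pow, MvPolynomial.aeval_C, Algebra.algebraMap_self,
        RingHom.id_apply] at hP
      obtain ⟨ha, hb⟩ := (sum_coeff_mul_pow_eq_zero_iff hp hd _ _).mp hP
      obtain ⟨q₁, hq₁, q₂, hq₂, rfl⟩ := Submodule.mem_sup.mp hq
      rw [map_add, h₁ P ha q₁ hq₁, h₂ P hb q₂ hq₂, add_zero]

/-- An ideal of polynomials without rational zeros contains a polynomial without rational zeros. -/
lemma exists_mem_forall_aeval_ne_zero {n : ℕ} (J : Ideal (MvPolynomial (Fin n) k))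
    (hJ : ∀ P : Fin n → k, ∃ q ∈ J, MvPolynomial.aeval P q ≠ 0) :
    ∃ d ∈ J, ∀ P : Fin n → k, MvPolynomial.aeval P d ≠ 0 := by
  by_cases h : IsAlgClosed k
  · refine ⟨1, ?_, fun P => by rw [map_one]; exact one_ne_zero⟩
    rw [← Ideal.eq_top_iff_one]
    -- Nullstellensatz: a proper ideal would lie in the maximal ideal of some rational point,
    -- against `hJ`.
    by_contra hne
    obtain ⟨M, hM, hJM⟩ := J.exists_le_maximal hne
    obtain ⟨P, rfl⟩ := MvPolynomial.isMaximal_iff_eq_vanishingIdeal_singleton.mp hM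
    obtain ⟨q, hq, hq0⟩ := hJ P
    exact hq0 (MvPolynomial.mem_vanishingIdeal_singleton_iff P q |>.mp (hJM hq))
  · obtain ⟨d, hd, hd'⟩ := exists_mem_eval_eq_zero_iff h (IsNoetherian.noetherian J)
    refine ⟨d, hd, fun P hP => ?_⟩
    obtain ⟨q, hq, hq0⟩ := hJ P
    exact hq0 (hd' P hP q hq)

end Polynomials

/-! ### Regular functions and maximal ideals of an affine algebraic subvariety -/

section AffinePoints

variable {k : Type u} [Field k] {n : ℕ} {I : Ideal (MvPolynomial (Fin n) k)}

/-- Evaluation of polynomials at a point of an algebraic set. -/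
def polyEval (P : {P : AffineSpace k n // P ∈ zeroSet I}) : MvPolynomial (Fin n) k →ₐ[k] k :=
  MvPolynomial.aeval P.1

/-- Polynomial functions are regular. -/
def polySection (I : Ideal (MvPolynomial (Fin n) k)) :
    MvPolynomial (Fin n) k →ₐ[k] (affineData I).sections ⊤ :=
  (affineData I).toGlobal

/-- Evaluation of regular functions at a point of an algebraic set. -/
def evalSection (P : {P : AffineSpace k n // P ∈ zeroSet I}) :
    (affineData I).sections ⊤ →ₐ[k] k :=
  (Pi.evalAlgHom k (fun y : (⊤ : Opens (affineData I).space) => (affineData I).fiber y.1)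
    ⟨P, trivial⟩).comp ((affineData I).sections ⊤).val

lemma evalSection_polySection (P : {P : AffineSpace k n // P ∈ zeroSet I})
    (p : MvPolynomial (Fin n) k) : evalSection P (polySection I p) = polyEval P p := rfl

lemma ext_of_evalSection {s t : (affineData I).sections ⊤}
    (h : ∀ P, evalSection P s = evalSection P t) : s = t :=
  Subtype.ext (funext fun P => h P.1)

lemma isOpen_polyEval_ne_zero (q : MvPolynomial (Fin n) k) :
    IsOpen {P : {P : AffineSpace k n // P ∈ zeroSet I} | polyEval P q ≠ 0} :=
  (affineData I).isOpen_ne_zero q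

/-- Principal opens form a basis: the complement of an open set is cut out by an ideal, some element
of which is nonzero at P. The polynomial q later serves to extend local identities by zero. -/
lemma exists_polyEval_ne_zero_of_mem {W : Set {P : AffineSpace k n // P ∈ zeroSet I}}
    (hW : IsOpen W) {P : {P : AffineSpace k n // P ∈ zeroSet I}} (hP : P ∈ W) :
    ∃ q : MvPolynomial (Fin n) k, polyEval P q ≠ 0 ∧ ∀ Q, polyEval Q q ≠ 0 → Q ∈ W := by
  obtain ⟨W', ⟨J, hJ⟩, rfl⟩ := isOpen_induced_iff.mp hW
  have hmem (Q : {P : AffineSpace k n // P ∈ zeroSet I}) : Q.1 ∈ W' ↔ Q.1 ∉ zeroSet J := by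
    rw [show zeroSet J = W'ᶜ from hJ, Set.notMem_compl_iff]
  obtain ⟨q, hq⟩ := not_forall.mp ((hmem P).mp hP)
  obtain ⟨hq, hq0⟩ := Classical.not_imp.mp hq
  exact ⟨q, hq0, fun Q hQ => (hmem Q).mpr fun hQJ => hQ (hQJ q hq)⟩

lemma exists_evalSection_mul_eq_near (s : (affineData I).sections ⊤)
    (P : {P : AffineSpace k n // P ∈ zeroSet I}) :
    ∃ q u v : MvPolynomial (Fin n) k, polyEval P q ≠ 0 ∧ ∀ Q, polyEval Q q ≠ 0 →
      polyEval Q v ≠ 0 ∧ evalSection Q s * polyEval Q v = polyEval Q u := by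
  obtain ⟨W, hPW, -, u, v, huv⟩ := s.2 P trivial
  obtain ⟨q, hq, hqW⟩ := exists_polyEval_ne_zero_of_mem W.2 hPW
  exact ⟨q, u, v, hq, fun Q hQ => huv Q trivial (hqW Q hQ)⟩

lemma exists_mem_aeval_ne_zero_of_notMem {P : AffineSpace k n} (hP : P ∉ zeroSet I) :
    ∃ q ∈ I, MvPolynomial.aeval (R := k) (S₁ := k) P q ≠ 0 := by
  obtain ⟨q, hq⟩ := not_forall.mp hP
  exact ⟨q, Classical.not_imp.mp hq⟩

lemma polySection_eq_zero {q : MvPolynomial (Fin n) k} (hq : q ∈ I) : polySection I q = 0 :=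
  ext_of_evalSection fun P => (P.2 q hq).trans (map_zero _).symm

/-- A regular function on an affine algebraic subvariety is a fraction of polynomials, with a
denominator without rational zero. -/
lemma exists_mul_polySection_eq (s : (affineData I).sections ⊤) :
    ∃ g h : MvPolynomial (Fin n) k, (∀ P : {P : AffineSpace k n // P ∈ zeroSet I},
      polyEval P h ≠ 0) ∧ s * polySection I h = polySection I g := by
  -- The ideal of denominators of s. It contains I, so it suffices to exhibit denominators
  -- nonvanishing at each point of V.
  let J : Ideal (MvPolynomial (Fin n) k) :=
    { carrier := {h | ∃ g, s * polySection I h = polySection I g}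
      zero_mem' := ⟨0, by rw [map_zero, mul_zero]⟩
      add_mem' := by
        rintro h₁ h₂ ⟨g₁, hg₁⟩ ⟨g₂, hg₂⟩
        exact ⟨g₁ + g₂, by rw [map_add, mul_add, hg₁, hg₂, map_add]⟩
      smul_mem' := by
        rintro c h ⟨g, hg⟩
        exact ⟨c * g, by rw [smul_eq_mul, map_mul, mul_left_comm, hg, map_mul]⟩ }
  obtain ⟨h, ⟨g, hg⟩, hh⟩ := exists_mem_forall_aeval_ne_zero J fun P => by
    by_cases hP : P ∈ zeroSet I
    · obtain ⟨q, u, v, hq, huv⟩ := exists_evalSection_mul_eq_near s ⟨P, hP⟩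
      -- Locally s = u / v where q ≠ 0. Multiplying by q makes the identity global, both sides being
      -- zero where q vanishes.
      refine ⟨q * v, ⟨q * u, ext_of_evalSection fun Q => ?_⟩, ?_⟩
      · simp only [map_mul, evalSection_polySection]
        by_cases hQ : polyEval Q q = 0
        · rw [hQ, zero_mul, zero_mul, mul_zero]
        · rw [← (huv Q hQ).2]
          ring
      · rw [map_mul]
        exact mul_ne_zero hq (huv _ hq).1
    · obtain ⟨q, hq, hq0⟩ := exists_mem_aeval_ne_zero_of_notMem hP
      exact ⟨q, ⟨0, by rw [polySection_eq_zero hq, map_zero, mul_zero]⟩, hq0⟩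
  exact ⟨g, h, fun P => hh P.1, hg⟩

variable {A : Type u} [CommRing A] [Algebra k A] (e : A ≃ₐ[k] (affineData I).sections ⊤)

/-- Evaluation at a point, on an algebra identified with the regular functions. -/
def evalPoint (P : {P : AffineSpace k n // P ∈ zeroSet I}) : A →ₐ[k] k :=
  (evalSection P).comp e.toAlgHom

/-- Polynomial functions, in an algebra identified with the regular functions. -/
def polyHom : MvPolynomial (Fin n) k →ₐ[k] A :=
  e.symm.toAlgHom.comp (polySection I)

lemma evalPoint_polyHom (P : {P : AffineSpace k n // P ∈ zeroSet I})
    (p : MvPolynomial (Fin n) k) : evalPoint e P (polyHom e p) = polyEval P p :=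
  (congrArg (evalSection P) (e.apply_symm_apply _)).trans (evalSection_polySection P p)

lemma exists_mul_polyHom_eq (a : A) :
    ∃ g h : MvPolynomial (Fin n) k, (∀ P : {P : AffineSpace k n // P ∈ zeroSet I},
      polyEval P h ≠ 0) ∧ a * polyHom e h = polyHom e g := by
  obtain ⟨g, h, hh, hg⟩ := exists_mul_polySection_eq (e a)
  refine ⟨g, h, hh, e.injective ?_⟩
  rw [map_mul]
  exact (congrArg (e a * ·) (e.apply_symm_apply _)).trans (hg.trans (e.apply_symm_apply _).symm)

lemma exists_evalPoint_mul_eq (a : A) :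
    ∃ g h : MvPolynomial (Fin n) k, ∀ P : {P : AffineSpace k n // P ∈ zeroSet I},
      polyEval P h ≠ 0 ∧ evalPoint e P a * polyEval P h = polyEval P g := by
  obtain ⟨g, h, hh, hg⟩ := exists_mul_polyHom_eq e a
  refine ⟨g, h, fun P => ⟨hh P, ?_⟩⟩
  rw [← evalPoint_polyHom e, ← evalPoint_polyHom e, ← hg, map_mul]

lemma isOpen_evalPoint_ne_zero (a : A) :
    IsOpen {P : {P : AffineSpace k n // P ∈ zeroSet I} | evalPoint e P a ≠ 0} := by
  obtain ⟨g, h, hgh⟩ := exists_evalPoint_mul_eq e a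
  convert isOpen_polyEval_ne_zero g using 1
  refine Set.ext fun P => ?_
  change evalPoint e P a ≠ 0 ↔ polyEval P g ≠ 0
  rw [← (hgh P).2]
  exact ⟨fun h => mul_ne_zero h (hgh P).1, fun h => left_ne_zero_of_mul h⟩

/-- The maximal ideal of the functions vanishing at a point. -/
def idealPoint (P : {P : AffineSpace k n // P ∈ zeroSet I}) : MaximalSpectrum A :=
  ⟨RingHom.ker (evalPoint e P), RingHom.ker_isMaximal_of_surjective (evalPoint e P)
    fun c => ⟨algebraMap k A c, AlgHom.commutes _ _⟩⟩

lemma mem_idealPoint {P : {P : AffineSpace k n // P ∈ zeroSet I}} {a : A} :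
    a ∈ (idealPoint e P).asIdeal ↔ evalPoint e P a = 0 := Iff.rfl

/-- The difference of a and the constant a(P) vanishes at P, so every residue class is a scalar. -/
lemma mk_idealPoint (P : {P : AffineSpace k n // P ∈ zeroSet I}) (a : A) :
    Ideal.Quotient.mk (idealPoint e P).asIdeal a =
      algebraMap k (A ⧸ (idealPoint e P).asIdeal) (evalPoint e P a) := by
  change _ = Ideal.Quotient.mk (idealPoint e P).asIdeal (algebraMap k A (evalPoint e P a))
  rw [Ideal.Quotient.eq, mem_idealPoint, map_sub, AlgHom.commutes]
  exact sub_self _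

/-- Every maximal ideal of the algebra of an affine algebraic subvariety is the ideal of a point. -/
lemma idealPoint_surjective : Function.Surjective (idealPoint e) := by
  intro m
  suffices ∃ P, ∀ a ∈ m.asIdeal, evalPoint e P a = 0 by
    obtain ⟨P, hP⟩ := this
    exact ⟨P, MaximalSpectrum.ext
      (m.isMaximal.eq_of_le (idealPoint e P).isMaximal.ne_top fun a ha => hP a ha).symm⟩
  -- If m vanished entirely at no point, its contraction to the polynomial ring would have no
  -- rational zero: numerators of elements of m take care of points of V, elements of I of the
  -- others. The contraction would then contain a polynomial d without rational zeros, whose image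
  -- is a unit lying in m.
  by_contra! hc
  obtain ⟨d, hd, hd0⟩ := exists_mem_forall_aeval_ne_zero (m.asIdeal.comap (polyHom e)) fun P => by
    by_cases hP : P ∈ zeroSet I
    · obtain ⟨a, ha, ha0⟩ := hc ⟨P, hP⟩
      obtain ⟨g, h, hh, hg⟩ := exists_mul_polyHom_eq e a
      refine ⟨g, ?_, ?_⟩
      · rw [Ideal.mem_comap, ← hg]
        exact Ideal.mul_mem_right _ _ ha
      · change polyEval ⟨P, hP⟩ g ≠ 0
        rw [← evalPoint_polyHom e, ← hg, map_mul, evalPoint_polyHom]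
        exact mul_ne_zero ha0 (hh _)
    · obtain ⟨q, hq, hq0⟩ := exists_mem_aeval_ne_zero_of_notMem hP
      refine ⟨q, ?_, hq0⟩
      have : polyHom e q = 0 :=
        (congrArg e.symm (polySection_eq_zero hq)).trans (map_zero e.symm)
      rw [Ideal.mem_comap, this]
      exact m.asIdeal.zero_mem
  have hu : IsUnit (polySection I d) := (affineData I).isUnit_section _ fun P => hd0 P.1.1
  exact m.isMaximal.ne_top (Ideal.eq_top_of_isUnit_mem _ hd (hu.map e.symm))

lemma idealPoint_injective : Function.Injective (idealPoint e) := by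
  intro P Q h
  refine Subtype.ext (funext fun i => ?_)
  -- This polynomial vanishes at P, and at Q only if the i-th coordinates agree.
  let p : MvPolynomial (Fin n) k := MvPolynomial.X i - MvPolynomial.C (P.1 i)
  have hval (R : {P : AffineSpace k n // P ∈ zeroSet I}) :
      polyEval R p = R.1 i - P.1 i := by
    exact (map_sub _ _ _).trans
      (congrArg₂ (· - ·) (MvPolynomial.aeval_X _ _) (MvPolynomial.aeval_C _ _))
  have ha : polyHom e p ∈ (idealPoint e P).asIdeal := by
    rw [mem_idealPoint, evalPoint_polyHom, hval, sub_self]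
  rw [h, mem_idealPoint, evalPoint_polyHom, hval] at ha
  exact (sub_eq_zero.mp ha).symm

/-- The points of an affine algebraic subvariety are the maximal ideals of its algebra. -/
def idealPointEquiv : {P : AffineSpace k n // P ∈ zeroSet I} ≃ MaximalSpectrum A :=
  Equiv.ofBijective (idealPoint e) ⟨idealPoint_injective e, idealPoint_surjective e⟩

lemma continuous_idealPointEquiv : Continuous (idealPointEquiv e) := by
  refine continuous_induced_rng.mpr ?_
  refine PrimeSpectrum.isTopologicalBasis_basic_opens.continuous_iff.mpr ?_
  rintro _ ⟨a, rfl⟩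
  exact isOpen_evalPoint_ne_zero e a

lemma continuous_idealPointEquiv_symm : Continuous (idealPointEquiv e).symm := by
  refine continuous_def.mpr fun W hW => isOpen_iff_forall_mem_open.mpr fun m hm => ?_
  obtain ⟨P, rfl⟩ := (idealPointEquiv e).surjective m
  rw [Set.mem_preimage, Equiv.symm_apply_apply] at hm
  obtain ⟨q, hq, hqW⟩ := exists_polyEval_ne_zero_of_mem hW hm
  have hmem (Q : {P : AffineSpace k n // P ∈ zeroSet I}) :
      polyHom e q ∉ (idealPointEquiv e Q).asIdeal ↔ polyEval Q q ≠ 0 := by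
    rw [← evalPoint_polyHom e]
    exact not_congr (mem_idealPoint e)
  refine ⟨{m | polyHom e q ∉ m.asIdeal}, fun m hm => ?_, ?_, (hmem P).mpr hq⟩
  · obtain ⟨Q, rfl⟩ := (idealPointEquiv e).surjective m
    rw [Set.mem_preimage, Equiv.symm_apply_apply]
    exact hqW Q ((hmem Q).mp hm)
  · exact (PrimeSpectrum.basicOpen (polyHom e q)).2.preimage
      MaximalSpectrum.toPrimeSpectrum_continuous

/-- The homeomorphism between an affine algebraic subvariety and the maximal spectrum of its
algebra. -/
def idealPointHomeomorph : {P : AffineSpace k n // P ∈ zeroSet I} ≃ₜ MaximalSpectrum A where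
  toEquiv := idealPointEquiv e
  continuous_toFun := continuous_idealPointEquiv e
  continuous_invFun := continuous_idealPointEquiv_symm e

lemma mk_eq_algebraMap_evalPoint (m : MaximalSpectrum A) (a : A) :
    Ideal.Quotient.mk m.asIdeal a =
      algebraMap k (A ⧸ m.asIdeal) (evalPoint e ((idealPointHomeomorph e).symm m) a) := by
  obtain ⟨P, rfl⟩ := (idealPointHomeomorph e).surjective m
  rw [Homeomorph.symm_apply_apply]
  exact mk_idealPoint e P a

include e in
lemma algebraMap_quotient_bijective (m : MaximalSpectrum A) :
    Function.Bijective (algebraMap k (A ⧸ m.asIdeal)) := by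
  have := Ideal.Quotient.nontrivial_iff.mpr m.isMaximal.ne_top
  refine ⟨(algebraMap k (A ⧸ m.asIdeal)).injective, fun x => ?_⟩
  obtain ⟨a, rfl⟩ := Ideal.Quotient.mk_surjective x
  exact ⟨_, (mk_eq_algebraMap_evalPoint e m a).symm⟩

/-- The morphism from the maximal spectrum of the algebra of an affine algebraic subvariety to that
subvariety. -/
def spmDataHomAffineData : (spmData (k := k) A).Hom (affineData I) where
  base := TopCat.ofHom (X := MaximalSpectrum A) (Y := {P : AffineSpace k n // P ∈ zeroSet I})
    ⟨(idealPointHomeomorph e).symm, (idealPointHomeomorph e).symm.continuous⟩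
  ringHom := polyHom e
  fiberHom m := Algebra.ofId k (A ⧸ m.asIdeal)
  fiberHom_eval m p := ((mk_eq_algebraMap_evalPoint e m (polyHom e p)).trans
    (congrArg _ (evalPoint_polyHom e _ p))).symm

/-- All residue fields are k, so sections on both sides are k-valued functions on homeomorphic
spaces. What remains is that a local fraction of elements of A is a local fraction of polynomials,
which holds since each element of A is itself such a fraction. -/
lemma spmDataHomAffineData_onSections_bijective (U : Opens (affineData I).space) :
    Function.Bijective ((spmDataHomAffineData e).onSections U) := by
  constructor
  · intro s t h
    refine Subtype.ext (funext fun P => ?_)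
    obtain ⟨P, hP⟩ := P
    obtain ⟨m, rfl⟩ := (idealPointHomeomorph e).symm.surjective P
    exact (algebraMap_quotient_bijective e m).injective
      (congrFun (congrArg Subtype.val h) ⟨m, hP⟩)
  · intro t
    have hU (P : {P : AffineSpace k n // P ∈ zeroSet I}) (hP : P ∈ U) :
        idealPoint e P ∈ (Opens.map (spmDataHomAffineData e).base).obj U :=
      show (idealPointHomeomorph e).symm (idealPointHomeomorph e P) ∈ U by
        rwa [Homeomorph.symm_apply_apply]
    choose s hs using fun P : U => (algebraMap_quotient_bijective e (idealPoint e P.1)).surjective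
      (t.1 ⟨idealPoint e P.1, hU P.1 P.2⟩)
    refine ⟨⟨s, fun P hP => ?_⟩, Subtype.ext (funext fun m => ?_)⟩
    · obtain ⟨W, hPW, -, u, v, huv⟩ := t.2 (idealPoint e P) (hU P hP)
      obtain ⟨g, h, hgh⟩ := exists_evalPoint_mul_eq e u
      obtain ⟨g', h', hgh'⟩ := exists_evalPoint_mul_eq e v
      -- With u = g / h and v = g' / h', the quotient u / v is (g * h') / (g' * h).
      refine ⟨U ⊓ ⟨_, W.2.preimage (idealPointHomeomorph e).continuous⟩, ⟨hP, hPW⟩, inf_le_left,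
        (g * h' : MvPolynomial (Fin n) k), (g' * h : MvPolynomial (Fin n) k), fun Q hQ hQW => ?_⟩
      obtain ⟨hv, hsv⟩ := huv (idealPoint e Q) (hU Q hQ) hQW.2
      obtain ⟨hh, hg⟩ := hgh Q
      obtain ⟨hh', hg'⟩ := hgh' Q
      have hv' : evalPoint e Q v ≠ 0 := fun h0 =>
        hv ((mk_idealPoint e Q v).trans ((congrArg _ h0).trans (map_zero _)))
      have hsv' : s ⟨Q, hQ⟩ * evalPoint e Q v = evalPoint e Q u := by
        apply (algebraMap_quotient_bijective e (idealPoint e Q)).injective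
        exact (map_mul _ _ _).trans ((congrArg₂ (· * ·) (hs ⟨Q, hQ⟩)
          (mk_idealPoint e Q v).symm).trans (hsv.trans (mk_idealPoint e Q u)))
      change polyEval Q (g' * h) ≠ 0 ∧ s ⟨Q, hQ⟩ * polyEval Q (g' * h) = polyEval Q (g * h')
      rw [map_mul, map_mul, ← hg, ← hg', ← hsv']
      exact ⟨mul_ne_zero (mul_ne_zero hv' hh') hh, by ring⟩
    · obtain ⟨m, hm⟩ := m
      obtain ⟨P, rfl⟩ := (idealPointHomeomorph e).surjective m
      have hP : (idealPointHomeomorph e).symm (idealPointHomeomorph e P) = P :=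
        Homeomorph.symm_apply_apply _ _
      have hPU : P ∈ U := hP ▸ (show (idealPointHomeomorph e).symm _ ∈ U from hm)
      refine Eq.trans ?_ (hs ⟨P, hPU⟩)
      -- The section is evaluated at the round trip of P through the homeomorphism, which is only
      -- propositionally equal to P.
      exact congrArg (fun Q : U => algebraMap k (A ⧸ (idealPoint e P).asIdeal) (s Q))
        (Subtype.ext hP)

end AffinePoints

lemma FracData.isUnit_germ_toGlobal_iff {k : Type u} [Field k] (X : FracData k) (x : X.space)
    (a : X.ring) :
    IsUnit ((X.presheaf.germ ⊤ x trivial).hom (X.toGlobal a)) ↔ X.eval x a ≠ 0 := by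
  have heval : (X.stalkEval x).hom ((X.presheaf.germ ⊤ x trivial).hom (X.toGlobal a)) =
      X.eval x a := X.stalkEval_germ x ⊤ trivial (X.toGlobal a)
  constructor
  · intro h
    have := (X.isField_fiber x).nontrivial
    have h2 : IsUnit (X.eval x a) := by
      rw [← heval]
      exact h.map (X.stalkEval x).hom
    exact h2.ne_zero
  · intro h
    refine X.isUnit_of_stalkEval_ne_zero _ _ ?_
    rw [heval]
    exact h

/-! ### Morphisms to a maximal spectrum are determined by global sections -/

section SpmHom

variable {k : Type u} [Field k] {A : CommAlgCat.{u} k} {X : LRSAlg k}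

/-- The morphism `A → Γ(X)` underlying a morphism `X → Spm(A)`. -/
def globalHom (α : X ⟶ spm A) : A ⟶ (LRSAlg.Γ k).obj (op X) :=
  toΓSpm A ≫ (LRSAlg.Γ k).map α.op

/-- The stalk map at x is local, so the germ of a at the image of x is a unit exactly when its image
at x is. The former means that a is nonzero in the residue field, that is, a lies outside the
maximal ideal. -/
lemma mem_base_iff (α : X ⟶ spm A) (x : X.carrier) (a : A) :
    a ∈ (show MaximalSpectrum A from α.base x).asIdeal ↔
      (X.presheaf.germ ⊤ x trivial).hom ((globalHom α).hom a) ∈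
        IsLocalRing.maximalIdeal (X.presheaf.stalk x) := by
  have hstalk : (X.presheaf.germ ⊤ x trivial).hom ((globalHom α).hom a) =
      (α.toHom.stalkMap x).hom (((spmData (k := k) A).presheaf.germ ⊤ (α.base x) trivial).hom
        ((spmData A).toGlobal a)) :=
    (DFunLike.congr_fun (congrArg CommAlgCat.Hom.hom
      (PresheafedSpace.stalkMap_germ α.toHom ⊤ x trivial)) ((spmData A).toGlobal a)).symm
  have h1 := α.isLocalHom x
  rw [IsLocalRing.mem_maximalIdeal, mem_nonunits_iff, hstalk]
  refine (not_iff_comm.mp ?_).symm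
  refine Iff.trans ?_ (((spmData (k := k) A).isUnit_germ_toGlobal_iff (α.base x) a).symm.trans
    ⟨fun h => h.map (α.toHom.stalkMap x).hom, fun h => h1.map_nonunit _ h⟩)
  exact not_congr Ideal.Quotient.eq_zero_iff_mem.symm

/-- A section without zeros on Spm(A) is invertible, so v is a unit over W; this and the relation s
* v = u are carried over by the pullback of sections. The value of the pullback of s is thereby
forced by `globalHom`. -/
lemma isUnit_and_map_mul_eq_of_eqFrac (α : X ⟶ spm A) (U W : Opens (spmData (k := k) A).space)
    (hWU : W ≤ U) (s : (spmData (k := k) A).sections U) (u v : A)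
    (h : (spmData A).EqFrac s.1 W u v) :
    IsUnit ((X.presheaf.map (homOfLE (le_top : (Opens.map α.base).obj W ≤ ⊤)).op).hom
      ((globalHom α).hom v)) ∧
    (X.presheaf.map ((Opens.map α.base).map (homOfLE hWU)).op).hom ((α.c.app (op U)).hom s) *
      (X.presheaf.map (homOfLE (le_top : (Opens.map α.base).obj W ≤ ⊤)).op).hom
        ((globalHom α).hom v) =
    (X.presheaf.map (homOfLE (le_top : (Opens.map α.base).obj W ≤ ⊤)).op).hom
      ((globalHom α).hom u) := by
  have hnat {U W : Opens (spmData (k := k) A).space} (hWU : W ≤ U)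
      (t : (spmData (k := k) A).sections U) :
      (X.presheaf.map ((Opens.map α.base).map (homOfLE hWU)).op).hom ((α.c.app (op U)).hom t) =
      (α.c.app (op W)).hom ((spmData (k := k) A).res hWU t) :=
    (DFunLike.congr_fun (congrArg CommAlgCat.Hom.hom
      (α.c.naturality (homOfLE hWU).op)) t).symm
  have hglob (a : A) :
      (X.presheaf.map (homOfLE (le_top : (Opens.map α.base).obj W ≤ ⊤)).op).hom
        ((globalHom α).hom a) =
      (α.c.app (op W)).hom ((spmData (k := k) A).res le_top ((spmData A).toGlobal a)) :=
    hnat le_top ((spmData A).toGlobal a)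
  rw [hglob, hglob, hnat]
  constructor
  · exact ((spmData (k := k) A).isUnit_section _ fun x => (h x.1 (hWU x.2) x.2).1).map
      (α.c.app (op W)).hom
  · refine (map_mul (α.c.app (op W)).hom _ _).symm.trans (congrArg (α.c.app (op W)).hom ?_)
    exact Subtype.ext (funext fun x => (h x.1 (hWU x.2) x.2).2)

/-- A morphism to `Spm(A)` is determined by the underlying morphism from `A` to the global
sections. -/
lemma hom_spm_ext {α β : X ⟶ spm A} (h : globalHom α = globalHom β) : α = β := by
  have hbase : α.base = β.base := by
    refine ConcreteCategory.hom_ext _ _ fun x => ?_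
    refine MaximalSpectrum.ext (Ideal.ext fun a => ?_)
    have hα := mem_base_iff α x a
    rw [h] at hα
    exact hα.trans (mem_base_iff β x a).symm
  obtain ⟨⟨b, c⟩, hα⟩ := α
  obtain ⟨⟨b', c'⟩, hβ⟩ := β
  -- Identifying the continuous maps first puts the two maps of sheaves over the same base, where
  -- they can be compared.
  obtain rfl : b = b' := hbase
  suffices c = c' by subst this; rfl
  refine NatTrans.ext (funext fun U => CommAlgCat.hom_ext (AlgHom.ext fun s => ?_))
  have hs := s.2
  choose! W hxW hWU u v huv using hs
  -- The preimages of the opens on which s is a fraction u / v cover. On each, both pullbacks of s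
  -- solve the same equation with invertible coefficient v.
  refine TopCat.Sheaf.eq_of_locally_eq' (F := ⟨X.presheaf, X.IsSheaf⟩)
    (fun x : U.unop => (Opens.map b).obj (W x.1)) ((Opens.map b).obj U.unop)
    (fun x => (Opens.map b).map (homOfLE (hWU x.1 x.2)))
    (fun y hy => Opens.mem_iSup.mpr ⟨⟨b y, hy⟩, hxW (b y) hy⟩) _ _ fun x => ?_
  obtain ⟨h1, h2⟩ := isUnit_and_map_mul_eq_of_eqFrac (⟨⟨b, c⟩, hα⟩ : X ⟶ spm A) U.unop (W x.1)
    (hWU x.1 x.2) s (u x.1) (v x.1) (huv x.1 x.2)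
  obtain ⟨-, h3⟩ := isUnit_and_map_mul_eq_of_eqFrac (⟨⟨b, c'⟩, hβ⟩ : X ⟶ spm A) U.unop (W x.1)
    (hWU x.1 x.2) s (u x.1) (v x.1) (huv x.1 x.2)
  rw [← h] at h3
  exact h1.mul_right_cancel (h2.trans h3.symm)

/-- A morphism `X → Spm(Γ(X))` inducing the identity of `Γ(X)` is the canonical one. -/
lemma isCanonicalToSpmΓ_of_globalHom_eq_id {φ : X ⟶ spm ((LRSAlg.Γ k).obj (op X))}
    (h : globalHom φ = 𝟙 _) : IsCanonicalToSpmΓ φ := by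
  refine ⟨fun P a => ?_, fun U W hWU s u v huv => ?_⟩
  · have := mem_base_iff φ P a
    rwa [h] at this
  · have := isUnit_and_map_mul_eq_of_eqFrac φ U W hWU s u v huv
    rwa [h] at this

end SpmHom

/-! ### The isomorphism between an affine subvariety and the spectrum of its algebra -/

section Iso

variable {k : Type u} [Field k]

/-- A morphism of locally ringed spaces in `k`-algebras is an isomorphism if it is one of
ringed spaces. -/
def LRSAlg.isoOfIsIso {X Y : LRSAlg k} (f : X ⟶ Y)
    [h : IsIso (C := PresheafedSpace (CommAlgCat.{u} k)) f.toHom] : X ≅ Y where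
  hom := f
  inv :=
    { toHom := inv (C := PresheafedSpace (CommAlgCat.{u} k)) f.toHom
      -- The stalk maps of the inverse are isomorphisms, hence reflect units.
      isLocalHom := fun x => ⟨fun a ha => by
        let g : Y.toPresheafedSpace ⟶ X.toPresheafedSpace :=
          inv (C := PresheafedSpace (CommAlgCat.{u} k)) f.toHom
        have h2 := IsUnit.map (inv (g.stalkMap x)).hom ha
        have h3 : (inv (g.stalkMap x)).hom ((g.stalkMap x).hom a) = a := DFunLike.congr_fun (congrArg CommAlgCat.Hom.hom
          (IsIso.hom_inv_id (g.stalkMap x))) a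
        rwa [h3] at h2⟩ }
  hom_inv_id := LRSAlg.hom_ext (IsIso.hom_inv_id (C := PresheafedSpace (CommAlgCat.{u} k)) f.toHom)
  inv_hom_id := LRSAlg.hom_ext (IsIso.inv_hom_id (C := PresheafedSpace (CommAlgCat.{u} k)) f.toHom)

lemma FracData.Hom.isIso_toPresheafedSpaceHom {X Y : FracData k} (f : X.Hom Y) [IsIso f.base]
    (hf : ∀ U, Function.Bijective (f.onSections U)) :
    IsIso (C := PresheafedSpace (CommAlgCat.{u} k)) f.toPresheafedSpaceHom := by
  have h1 : ∀ U, IsIso (f.toPresheafedSpaceHom.c.app U) := fun U =>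
    (CommAlgCat.isoMk (AlgEquiv.ofBijective (f.onSections U.unop) (hf U.unop))).isIso_hom
  have h2 : IsIso f.toPresheafedSpaceHom.c := NatIso.isIso_of_isIso_app _
  have h3 : IsIso f.toPresheafedSpaceHom.base := ‹IsIso f.base›
  exact PresheafedSpace.isIso_of_components f.toPresheafedSpaceHom

variable {n : ℕ} {I : Ideal (MvPolynomial (Fin n) k)} {A : CommAlgCat.{u} k}
  (e : A ≅ (LRSAlg.Γ k).obj (op (affineSubvariety I)))

/-- The maximal spectrum of the algebra of an affine algebraic subvariety is isomorphic to that
subvariety. -/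
def spmIso : spm A ≅ affineSubvariety I :=
  let e' : A ≃ₐ[k] (affineData I).sections ⊤ := CommAlgCat.algEquivOfIso e
  have : IsIso (spmDataHomAffineData e').base :=
    (TopCat.isoOfHomeo (X := TopCat.of (MaximalSpectrum A))
      (Y := TopCat.of {P : AffineSpace k n // P ∈ zeroSet I})
      (idealPointHomeomorph e').symm).isIso_hom
  have : IsIso (C := PresheafedSpace (CommAlgCat.{u} k))
      (spmDataHomAffineData e').toLRSAlgHom.toHom :=
    (spmDataHomAffineData e').isIso_toPresheafedSpaceHom
      (spmDataHomAffineData_onSections_bijective e')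
  LRSAlg.isoOfIsIso (spmDataHomAffineData e').toLRSAlgHom (h := this)

/-- At m, the pullback of the regular function attached to a is its value at the point of m, viewed
in A / m; this is the class of a. The canonical map to the global sections is therefore a composite
of isomorphisms. -/
lemma toΓSpm_eq_comp_spmIso : toΓSpm A = e.hom ≫ (LRSAlg.Γ k).map (spmIso e).hom.op :=
  CommAlgCat.hom_ext (AlgHom.ext fun a => Subtype.ext (funext fun m =>
    mk_eq_algebraMap_evalPoint (A := A) (CommAlgCat.algEquivOfIso e) m.1 a))

include e in
lemma isIso_toΓSpm_of_iso : IsIso (toΓSpm A) := by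
  rw [toΓSpm_eq_comp_spmIso e]
  infer_instance

end Iso

/-! ### The adjoint equivalence -/

section Duality

variable (k : Type u) [Field k]

/-- The maximal spectrum is well defined on affine `*`-algebras. -/
lemma spmWellDefined : SpmWellDefined k where
  comap_isMaximal {A B} f m := by
    obtain ⟨-, n, I, ⟨e⟩⟩ := B.property
    let e' : B.obj ≃ₐ[k] (affineData I).sections ⊤ := CommAlgCat.algEquivOfIso e
    -- The maximal ideal is the kernel of an evaluation B → k, so its contraction is the kernel of a
    -- k-algebra map A → k, surjective because of the scalars.
    obtain ⟨P, rfl⟩ := idealPoint_surjective e' m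
    exact RingHom.ker_isMaximal_of_surjective ((evalPoint e' P).comp f.hom.hom)
      fun c => ⟨algebraMap k A.obj c, AlgHom.commutes _ _⟩
  isAffineEquivariety A := by
    obtain ⟨-, n, I, ⟨e⟩⟩ := A.property
    exact ⟨n, I, ⟨spmIso e⟩⟩

variable {k}

instance isIso_toΓSpm (A : AffineStarAlgebra k) : IsIso (toΓSpm A.obj) := by
  obtain ⟨-, n, I, ⟨e⟩⟩ := A.property
  exact isIso_toΓSpm_of_iso e

/-- Transport `spmIso` along a chart of V. The condition on `globalHom` determines the isomorphism
by `hom_spm_ext`, so neither the chart nor a later choice matters. -/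
lemma exists_iso_spm_Γ (V : AffineEquivariety k) :
    ∃ i : V.obj ≅ spm ((LRSAlg.Γ k).obj (op V.obj)), globalHom i.hom = 𝟙 _ := by
  obtain ⟨n, I, ⟨e⟩⟩ := V.property
  let e' := (LRSAlg.Γ k).mapIso e.symm.op
  refine ⟨e ≪≫ (spmIso e').symm, ?_⟩
  change toΓSpm _ ≫ (LRSAlg.Γ k).map ((spmIso e').inv.op ≫ e.hom.op) = 𝟙 _
  rw [toΓSpm_eq_comp_spmIso e', Category.assoc, ← Functor.map_comp, ← op_comp_assoc,
    Iso.inv_hom_id, op_id, Category.id_comp]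
  change (LRSAlg.Γ k).map e.inv.op ≫ _ = _
  rw [← Functor.map_comp, ← op_comp, Iso.hom_inv_id, op_id]
  exact (LRSAlg.Γ k).map_id _

/-- The canonical isomorphism from an affine algebraic equivariety to the maximal spectrum of its
algebra. -/
def isoSpmΓ (V : AffineEquivariety k) : V.obj ≅ spm ((LRSAlg.Γ k).obj (op V.obj)) :=
  (exists_iso_spm_Γ V).choose

lemma globalHom_isoSpmΓ (V : AffineEquivariety k) : globalHom (isoSpmΓ V).hom = 𝟙 _ :=
  (exists_iso_spm_Γ V).choose_spec

lemma toΓSpm_naturality {A B : AffineStarAlgebra k} (f : A ⟶ B) :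
    f.hom ≫ toΓSpm B.obj = toΓSpm A.obj ≫
      (LRSAlg.Γ k).map (spmMap f.hom.hom ((spmWellDefined k).comap_isMaximal f)).op := rfl

/-- By `hom_spm_ext` it is enough to compare the induced algebra maps, and both equal Γ(f). -/
lemma isoSpmΓ_naturality {V V' : AffineEquivariety k} (f : V ⟶ V')
    (hf : ∀ m : MaximalSpectrum ((LRSAlg.Γ k).obj (op V.obj)),
      (m.asIdeal.comap ((LRSAlg.Γ k).map f.hom.op).hom).IsMaximal) :
    (isoSpmΓ V).hom ≫ spmMap ((LRSAlg.Γ k).map f.hom.op).hom hf = f.hom ≫ (isoSpmΓ V').hom := by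
  apply hom_spm_ext
  have hV := globalHom_isoSpmΓ V
  have hV' := globalHom_isoSpmΓ V'
  unfold globalHom at hV hV' ⊢
  rw [op_comp, op_comp, Functor.map_comp, Functor.map_comp, reassoc_of% hV']
  exact congrArg ((LRSAlg.Γ k).map f.hom.op ≫ ·) hV

variable (k) in
/-- The unit of the duality. -/
def dualityUnit : 𝟭 (AffineEquivariety k)ᵒᵖ ≅ J k ⋙ K (spmWellDefined k) :=
  NatIso.ofComponents
    (fun V => (ObjectProperty.isoMk (IsAffineEquivariety k) (isoSpmΓ V.unop).symm).op)
    fun {V V'} f => by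
      refine Quiver.Hom.unop_inj (ObjectProperty.hom_ext _ ?_)
      refine (Iso.inv_comp_eq (isoSpmΓ V'.unop)).mpr ?_
      exact ((Iso.eq_comp_inv (isoSpmΓ V.unop)).mpr
        (isoSpmΓ_naturality f.unop _).symm).trans (Category.assoc _ _ _)

variable (k) in
/-- The counit of the duality. -/
def dualityCounit : K (spmWellDefined k) ⋙ J k ≅ 𝟭 (AffineStarAlgebra k) :=
  NatIso.ofComponents
    (fun A => (ObjectProperty.isoMk (IsAffineStarAlgebra k) (asIso (toΓSpm A.obj)).symm))
    fun {A B} f => by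
      refine ObjectProperty.hom_ext _ ?_
      exact (IsIso.eq_inv_comp (toΓSpm A.obj)).mpr ((Category.assoc _ _ _).symm.trans
        ((IsIso.comp_inv_eq (toΓSpm B.obj)).mpr (toΓSpm_naturality f).symm))

variable (k) in
/-- The duality between affine algebraic equivarieties and affine `*`-algebras. -/
def duality : (AffineEquivariety k)ᵒᵖ ≌ AffineStarAlgebra k where
  functor := J k
  inverse := K (spmWellDefined k)
  unitIso := dualityUnit k
  counitIso := dualityCounit k
  functor_unitIso_comp V := by
    refine ObjectProperty.hom_ext _ ?_
    -- The triangle identity says that the counit is inverse to `toΓSpm`, up to Γ of the canonical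
    -- isomorphism; this is the defining property of `isoSpmΓ`.
    have h : toΓSpm _ ≫ (LRSAlg.Γ k).map (isoSpmΓ V.unop).hom.op = 𝟙 _ :=
      globalHom_isoSpmΓ V.unop
    have := isIso_toΓSpm ((J k).obj V)
    refine (IsIso.comp_inv_eq (toΓSpm ((J k).obj V).obj)).mpr ?_
    refine Eq.trans ?_ (Category.id_comp _).symm
    exact (Iso.comp_hom_eq_id ((LRSAlg.Γ k).mapIso (isoSpmΓ V.unop).op)).mp h |>.symm

end Duality

end Equiresidual

end

theorem mainTheorem1 (k : Type u) [Field k] :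
    ∃ h : Equiresidual.SpmWellDefined k,
      (Equiresidual.J k).IsEquivalence ∧
      (Equiresidual.K h).IsEquivalence ∧
      ∃ adj : Equiresidual.J k ⊣ Equiresidual.K h,
        IsIso adj.unit ∧ IsIso adj.counit ∧
        (∀ A : Equiresidual.AffineStarAlgebra k,
          Equiresidual.toΓSpm A.obj ≫ (adj.counit.app A).hom = 𝟙 A.obj ∧
          (adj.counit.app A).hom ≫ Equiresidual.toΓSpm A.obj = 𝟙 _) ∧
        (∀ V : Equiresidual.AffineEquivariety k,
          ∃ φ : V.obj ⟶ Equiresidual.spm ((Equiresidual.LRSAlg.Γ k).obj (op V.obj)),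
            Equiresidual.IsCanonicalToSpmΓ φ ∧
            φ ≫ (adj.unit.app (op V)).unop.hom = 𝟙 V.obj ∧
            (adj.unit.app (op V)).unop.hom ≫ φ = 𝟙 _) :=
  ⟨Equiresidual.spmWellDefined k, (Equiresidual.duality k).isEquivalence_functor,
    (Equiresidual.duality k).isEquivalence_inverse, (Equiresidual.duality k).toAdjunction,
    (Equiresidual.duality k).unitIso.isIso_hom, (Equiresidual.duality k).counitIso.isIso_hom,
    fun A => ⟨IsIso.hom_inv_id (Equiresidual.toΓSpm A.obj),
      IsIso.inv_hom_id (Equiresidual.toΓSpm A.obj)⟩,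
    fun V => ⟨(Equiresidual.isoSpmΓ V).hom,
      Equiresidual.isCanonicalToSpmΓ_of_globalHom_eq_id (Equiresidual.globalHom_isoSpmΓ V),
      (Equiresidual.isoSpmΓ V).hom_inv_id, (Equiresidual.isoSpmΓ V).inv_hom_id⟩⟩
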